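/- Let $\mathbf D$ be the open unit disc, and let $H^2$ be the Hardy space of $\mathbf D$, i.e. the Hilbert space of functions $f(z)=\sum_{n\ge 0}a_nz^n$ on $\mathbf D$ with $\|f\|^2=\sum_n|a_n|^2<\infty$. Let $S$ be the unilateral shift on $H^2$, $(Sf)(z)=zf(z)$. For an inner function $\theta\in H^\infty$ (a bounded analytic function on $\mathbf D$ whose radial limits exist and have modulus $1$ almost everywhere on the unit circle), put $H(\theta)=H^2\ominus\theta H^2$, the orthogonal complement of $\theta H^2$ in $H^2$, and let the Jordan block $S(\theta)$ be the operator $S(\theta)=P_{H(\theta)}S|_{H(\theta)}$ on $H(\theta)$, where $P_{H(\theta)}$ is the orthogonal projection of $H^2$ onto $H(\theta)$. For a bounded operator $T$ let $\mathrm{Lat}(T)$ be the lattice of closed $T$-invariant subspaces, ordered by inclusion, in which the meet of $M$ and $N$ is $M\cap N$ and the join $M\vee N$ is the closed linear span of $M\cup N$. **Lemma.** For every inner function $\theta$ in $H^\infty$, the lattice $\mathrm{Lat}(S(\theta))$ is distributive: for all $L,M,N\in\mathrm{Lat}(S(\theta))$, $$L\cap(M\vee N)=(L\cap M)\vee(L\cap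 N).$$ -/

import Mathlib

open scoped Complex.UnitDisc

/-- `H^∞` inner functions on the open unit disc: bounded analytic functions whose radial limits
exist and are unimodular almost everywhere on the unit circle. Values of `θ` outside the open
disc play no role. -/
structure IsInnerFunction (θ : ℂ → ℂ) : Prop where
  analytic : DifferentiableOn ℂ θ (Metric.ball 0 1)
  bounded : ∃ C : ℝ, ∀ z ∈ Metric.ball (0 : ℂ) 1, ‖θ z‖ ≤ C
  radial : ∀ᵐ t : ℝ, ∃ w : ℂ, ‖w‖ = 1 ∧
    Filter.Tendsto (fun r : ℝ => θ (r * Complex.exp (t * Complex.I)))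
      (nhdsWithin 1 (Set.Iio 1)) (nhds w)

/-- The square-summable complex sequences `ℓ²(ℕ)`. -/
abbrev EllTwo : Type := lp (fun _ : ℕ => ℂ) 2

namespace EllTwo

theorem memlp_two_iff (a : ℕ → ℂ) :
    Memℓp a 2 ↔ Summable (fun n => ‖a n‖ ^ 2) := by
  rw [memℓp_gen_iff (by norm_num)]
  simp

theorem summable_power (a : EllTwo) (z : 𝔻) : Summable (fun n => a n * (z : ℂ) ^ n) := by
  refine Summable.of_norm_bounded (g := fun n => ‖a‖ * ‖(z : ℂ)‖ ^ n) ?_ ?_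
  · exact (summable_geometric_of_lt_one (norm_nonneg _) z.norm_lt_one).mul_left _
  · intro n
    rw [norm_mul, norm_pow]
    gcongr
    exact lp.norm_apply_le_norm (by norm_num) a n

/-- A function on the disc determines its power series coefficients. -/
theorem eq_of_hasSum (a b : EllTwo) (f : 𝔻 → ℂ)
    (ha : ∀ z : 𝔻, HasSum (fun n => a n * (z : ℂ) ^ n) (f z))
    (hb : ∀ z : 𝔻, HasSum (fun n => b n * (z : ℂ) ^ n) (f z)) : a = b := by
  have key : HasFPowerSeriesAt (fun _ : ℂ => (0 : ℂ))
      (FormalMultilinearSeries.ofScalars ℂ (fun n => a n - b n)) 0 := by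
    rw [hasFPowerSeriesAt_iff]
    filter_upwards [Metric.ball_mem_nhds (0 : ℂ) one_pos] with z hz
    have hz' : ‖z‖ < 1 := by simpa using hz
    have h := (ha (Complex.UnitDisc.mk z hz')).sub (hb (Complex.UnitDisc.mk z hz'))
    simp only [Complex.UnitDisc.coe_mk, sub_self] at h
    refine h.congr_fun ?_
    intro n
    simp [FormalMultilinearSeries.coeff_ofScalars]
    ring
  have h0 := key.eq_zero
  ext n
  have h1 := congrArg (fun p => FormalMultilinearSeries.coeff p n) h0
  simp only [FormalMultilinearSeries.coeff_ofScalars] at h1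
  have h2 : (0 : FormalMultilinearSeries ℂ ℂ ℂ).coeff n = 0 := by
    simp [FormalMultilinearSeries.coeff]
  exact sub_eq_zero.mp (h1.trans h2)

end EllTwo

/-- The functions on the open unit disc that are sums of a power series with square-summable
coefficients. -/
def hardySubmodule : Submodule ℂ (𝔻 → ℂ) where
  carrier := {f | ∃ a : ℕ → ℂ, Summable (fun n => ‖a n‖ ^ 2) ∧
    ∀ z : 𝔻, HasSum (fun n => a n * (z : ℂ) ^ n) (f z)}
  zero_mem' := ⟨0, by simp [summable_zero], fun z => by simp [hasSum_zero]⟩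
  add_mem' := by
    rintro f g ⟨a, ha, hf⟩ ⟨b, hb, hg⟩
    refine ⟨a + b, ?_, fun z => ?_⟩
    · rw [← EllTwo.memlp_two_iff] at *
      exact ha.add hb
    · simpa [add_mul] using (hf z).add (hg z)
  smul_mem' := by
    rintro c f ⟨a, ha, hf⟩
    refine ⟨c • a, ?_, fun z => ?_⟩
    · rw [← EllTwo.memlp_two_iff] at *
      exact ha.const_smul c
    · simpa [mul_assoc] using (hf z).mul_left c

/-- The Hardy space `H²` of the open unit disc. It is a separate type, so that its topology is the
one of its Hilbert norm below and not that of pointwise convergence. -/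
def HardyTwo : Type := hardySubmodule

namespace HardyTwo

noncomputable section

instance : AddCommGroup HardyTwo := inferInstanceAs (AddCommGroup hardySubmodule)

instance : Module ℂ HardyTwo := inferInstanceAs (Module ℂ hardySubmodule)

instance : CoeFun HardyTwo (fun _ => 𝔻 → ℂ) := ⟨fun f => f.1⟩

@[ext] theorem ext {f g : HardyTwo} (h : ∀ z, f z = g z) : f = g := Subtype.ext (funext h)

@[simp] theorem zero_apply (z : 𝔻) : (0 : HardyTwo) z = 0 := rfl

@[simp] theorem add_apply (f g : HardyTwo) (z : 𝔻) : (f + g) z = f z + g z := rfl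

@[simp] theorem smul_apply (c : ℂ) (f : HardyTwo) (z : 𝔻) : (c • f) z = c * f z := rfl

/-- The function `z ↦ ∑ aₙ zⁿ` of a square-summable sequence. -/
def ofCoeff : EllTwo →ₗ[ℂ] HardyTwo where
  toFun a := ⟨fun z => ∑' n, a n * (z : ℂ) ^ n, a, (EllTwo.memlp_two_iff _).1 (lp.memℓp a),
    fun z => (EllTwo.summable_power a z).hasSum⟩
  map_add' a b := by
    ext z
    have h := (EllTwo.summable_power a z).hasSum.add (EllTwo.summable_power b z).hasSum
    simp only [← add_mul] at h
    exact h.tsum_eq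
  map_smul' c a := by
    ext z
    have h := (EllTwo.summable_power a z).hasSum.mul_left c
    simp only [← mul_assoc] at h
    exact h.tsum_eq

theorem ofCoeff_hasSum (a : EllTwo) (z : 𝔻) :
    HasSum (fun n => a n * (z : ℂ) ^ n) (ofCoeff a z) :=
  (EllTwo.summable_power a z).hasSum

theorem ofCoeff_bijective : Function.Bijective ofCoeff := by
  constructor
  · intro a b h
    refine EllTwo.eq_of_hasSum a b (ofCoeff a) (ofCoeff_hasSum a) ?_
    rw [h]
    exact ofCoeff_hasSum b
  · rintro ⟨f, a, ha, hf⟩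
    refine ⟨⟨a, (EllTwo.memlp_two_iff a).2 ha⟩, ?_⟩
    ext z
    exact (hf z).tsum_eq

/-- The sequence of Taylor coefficients at the origin of a function in `H²`. -/
def coeff : HardyTwo ≃ₗ[ℂ] EllTwo := (LinearEquiv.ofBijective ofCoeff ofCoeff_bijective).symm

theorem coeff_hasSum (f : HardyTwo) (z : 𝔻) :
    HasSum (fun n => coeff f n * (z : ℂ) ^ n) (f z) := by
  have h := ofCoeff_hasSum (coeff f) z
  have h2 : ofCoeff (coeff f) = f :=
    (LinearEquiv.ofBijective ofCoeff ofCoeff_bijective).apply_symm_apply f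
  rwa [h2] at h

/-- `‖f‖² = ∑ |aₙ|²` where `f(z) = ∑ aₙ zⁿ`. -/
instance : NormedAddCommGroup HardyTwo :=
  NormedAddCommGroup.induced HardyTwo EllTwo coeff coeff.injective

/-- `⟪f, g⟫ = ∑ conj(aₙ) bₙ` where `f(z) = ∑ aₙ zⁿ` and `g(z) = ∑ bₙ zⁿ`. -/
instance : InnerProductSpace ℂ HardyTwo where
  toNormedSpace := NormedSpace.induced ℂ HardyTwo EllTwo coeff
  inner f g := inner ℂ (coeff f) (coeff g)
  norm_sq_eq_re_inner f := norm_sq_eq_re_inner (𝕜 := ℂ) (coeff f)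
  conj_inner_symm f g := inner_conj_symm (coeff f) (coeff g)
  add_left f g h := by rw [map_add, inner_add_left]
  smul_left f g c := by rw [map_smul, inner_smul_left]

/-- Taking coefficients is an isometry of `H²` onto `ℓ²`. -/
def coeffIsometry : HardyTwo ≃ₗᵢ[ℂ] EllTwo := ⟨coeff, fun _ => rfl⟩

instance : CompleteSpace HardyTwo :=
  coeffIsometry.toIsometryEquiv.completeSpace

/-- The coefficients of `z f(z)`. -/
def shiftSeq (a : ℕ → ℂ) : ℕ → ℂ
  | 0 => 0
  | n + 1 => a n

theorem hasSum_shiftSeq {a : ℕ → ℂ} {z s : ℂ} (h : HasSum (fun n => a n * z ^ n) s) :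
    HasSum (fun n => shiftSeq a n * z ^ n) (z * s) := by
  rw [← hasSum_nat_add_iff' 1]
  simp only [Finset.sum_range_one, shiftSeq, zero_mul, sub_zero]
  refine (h.mul_left z).congr_fun ?_
  intro n
  ring

theorem hasSum_norm_shiftSeq {a : ℕ → ℂ} {s : ℝ} (h : HasSum (fun n => ‖a n‖ ^ 2) s) :
    HasSum (fun n => ‖shiftSeq a n‖ ^ 2) s := by
  rw [← hasSum_nat_add_iff' 1]
  simpa [shiftSeq] using h

/-- Multiplication by the variable, as a linear map of `H²`. -/
def shiftLinear : HardyTwo →ₗ[ℂ] HardyTwo where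
  toFun f := ⟨fun z => z * f z, by
    obtain ⟨a, ha, hf⟩ := f.2
    exact ⟨shiftSeq a, (hasSum_norm_shiftSeq ha.hasSum).summable,
      fun z => hasSum_shiftSeq (hf z)⟩⟩
  map_add' f g := by
    ext z
    exact mul_add _ _ _
  map_smul' c f := by
    ext z
    exact mul_left_comm _ _ _

theorem hasSum_norm_sq (f : HardyTwo) : HasSum (fun n => ‖coeff f n‖ ^ 2) (‖f‖ ^ 2) := by
  have h := lp.hasSum_norm (p := 2) (by norm_num) (coeff f)
  have h2 : ‖coeff f‖ = ‖f‖ := rfl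
  rw [h2] at h
  simpa using h

theorem coeff_shiftLinear (f : HardyTwo) (n : ℕ) :
    coeff (shiftLinear f) n = shiftSeq (coeff f) n := by
  have hs : Memℓp (shiftSeq (coeff f)) 2 :=
    (EllTwo.memlp_two_iff _).2 (hasSum_norm_shiftSeq (hasSum_norm_sq f)).summable
  have h := EllTwo.eq_of_hasSum (coeff (shiftLinear f)) ⟨shiftSeq (coeff f), hs⟩ (shiftLinear f)
    (coeff_hasSum _) (fun z => hasSum_shiftSeq (coeff_hasSum f z))
  rw [h]

theorem norm_shiftLinear (f : HardyTwo) : ‖shiftLinear f‖ = ‖f‖ := by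
  have h1 := hasSum_norm_sq (shiftLinear f)
  simp only [coeff_shiftLinear] at h1
  have h2 := h1.unique (hasSum_norm_shiftSeq (hasSum_norm_sq f))
  exact (sq_eq_sq₀ (norm_nonneg _) (norm_nonneg _)).1 h2

/-- The unilateral shift `(S f)(z) = z f(z)` on `H²`, as a bounded operator. -/
def shift : HardyTwo →L[ℂ] HardyTwo :=
  shiftLinear.mkContinuous 1 (fun f => by rw [norm_shiftLinear, one_mul])

theorem shift_apply (f : HardyTwo) (z : 𝔻) : shift f z = z * f z := rfl

/-- The subspace `θ H² = {θ f : f ∈ H²}` of `H²`. -/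
def multiples (θ : ℂ → ℂ) : Submodule ℂ HardyTwo where
  carrier := {g | ∃ f : HardyTwo, ∀ z : 𝔻, g z = θ z * f z}
  zero_mem' := ⟨0, fun z => by simp⟩
  add_mem' := by
    rintro g₁ g₂ ⟨f₁, h₁⟩ ⟨f₂, h₂⟩
    exact ⟨f₁ + f₂, fun z => by simp [h₁ z, h₂ z, mul_add]⟩
  smul_mem' := by
    rintro c g ⟨f, h⟩
    exact ⟨c • f, fun z => by simp [h z, mul_left_comm]⟩

/-- The model space `H(θ) = H² ⊖ θ H²`. -/
abbrev modelSpace (θ : ℂ → ℂ) : Submodule ℂ HardyTwo := (multiples θ)ᗮ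

/-- The Jordan block `S(θ) = P S | H(θ)`, where `P` is the orthogonal projection of `H²` onto
`H(θ)`. -/
def jordanBlock (θ : ℂ → ℂ) : modelSpace θ →L[ℂ] modelSpace θ :=
  (modelSpace θ).orthogonalProjectionOnto ∘L shift ∘L (modelSpace θ).subtypeL

end

end HardyTwo

/-- `Lat(T)`: the closed invariant subspaces of a bounded operator `T`, ordered by inclusion, as a
sublattice of the lattice of all closed subspaces. The meet is the intersection and the join is the
closed linear span of the union. -/
def invariantLattice {E : Type*} [NormedAddCommGroup E] [InnerProductSpace ℂ E] (T : E →L[ℂ] E) :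
    Sublattice (ClosedSubmodule ℂ E) where
  carrier := {M | ∀ x ∈ M, T x ∈ M}
  supClosed' := by
    intro M hM N hN
    have h : M ⊔ N ≤ (M ⊔ N).comap T := by
      refine sup_le (fun x hx => ?_) (fun x hx => ?_)
      · exact (le_sup_left : M ≤ M ⊔ N) (hM x hx)
      · exact (le_sup_right : N ≤ M ⊔ N) (hN x hx)
    exact fun x hx => h hx
  infClosed' := by
    intro M hM N hN x hx
    exact ⟨hM x hx.1, hN x hx.2⟩

/-!
Distributivity is first proved for the closed invariant subspaces of the shift `S` on `H²`, and
then transferred to the Jordan block.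

*Beurling's theorem without boundary values.* Instead of inner functions, the argument uses the
isometries `U` of `H²` that are multiplications `U f = φ f`. Any two of them commute. A nonzero
closed `S`-invariant subspace `M` is the range of such an isometry
(`HardyTwo.exists_isMultiplication_range_eq`): it contains a unit vector `φ` orthogonal to `S M`,
because a function divisible by all powers of `z` vanishes; the vectors `Sⁿ φ` are then
orthonormal, so `∑ aₙ zⁿ ↦ ∑ aₙ Sⁿ φ` is an isometry, and it is multiplication by `φ`. The part of
`M` orthogonal to its range is again invariant. If it were not zero, it would contain the range of
multiplication by some `ψ`, and `φ ψ` would lie in two orthogonal subspaces.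

*Distributivity for the shift.* Closed invariant subspaces thus multiply like ideals, and they
satisfy the rules of the ideals of a Prüfer domain. With `Q = L ∨ M ∨ N` and
`P = (L ∩ M) ∨ (L ∩ N)`, the products `L M` and `L N` lie in `Q P`
(`HardyTwo.comp_mem_range_comp`), hence so does `(L ∩ (M ∨ N)) Q`; cancelling `Q` gives
`L ∩ (M ∨ N) ≤ P`.

*Transfer.* The orthogonal complement of `H(θ)` is `S`-invariant, since it is the closure of
`θ H²`. Therefore `N ↦ {f | P f ∈ N}`, with `P` the projection onto `H(θ)`, embeds the lattice of
`S(θ)` into that of `S`, and it respects meets and joins.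
-/

namespace HardyTwo

noncomputable section

/-! ### Point evaluation and divisibility by the variable -/

theorem norm_apply_le (f : HardyTwo) (z : 𝔻) : ‖f z‖ ≤ (1 - ‖(z : ℂ)‖)⁻¹ * ‖f‖ := by
  have hg := (hasSum_geometric_of_lt_one (norm_nonneg _) z.norm_lt_one).mul_right ‖f‖
  rw [← (coeff_hasSum f z).tsum_eq]
  refine tsum_of_norm_bounded hg fun n => ?_
  rw [norm_mul, norm_pow, mul_comm]
  gcongr
  exact lp.norm_apply_le_norm (by norm_num) (coeff f) n

/-- Evaluation at a point of the disc, as a bounded functional on `H²`. -/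
def evalCLM (z : 𝔻) : HardyTwo →L[ℂ] ℂ :=
  LinearMap.mkContinuous
    { toFun := fun f => f z
      map_add' := fun _ _ => rfl
      map_smul' := fun _ _ => rfl } (1 - ‖(z : ℂ)‖)⁻¹ (fun f => norm_apply_le f z)

theorem evalCLM_apply (z : 𝔻) (f : HardyTwo) : evalCLM z f = f z := rfl

theorem shift_pow_apply (n : ℕ) (f : HardyTwo) (z : 𝔻) :
    (shift ^ n) f z = (z : ℂ) ^ n * f z := by
  induction n with
  | zero => simp
  | succ n ih =>
    rw [pow_succ', mul_apply_eq_comp, shift_apply, ih]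
    ring

theorem norm_shift (f : HardyTwo) : ‖shift f‖ = ‖f‖ := norm_shiftLinear f

/-- The shift as a linear isometry. -/
def shiftIsometry : HardyTwo →ₗᵢ[ℂ] HardyTwo := ⟨shiftLinear, norm_shiftLinear⟩

theorem inner_shift_shift (f g : HardyTwo) : inner ℂ (shift f) (shift g) = inner ℂ f g :=
  shiftIsometry.inner_map_map f g

theorem inner_shift_pow (n : ℕ) (f g : HardyTwo) :
    inner ℂ ((shift ^ n) f) ((shift ^ n) g) = inner ℂ f g := by
  induction n with
  | zero => simp
  | succ n ih => rw [pow_succ', mul_apply_eq_comp, mul_apply_eq_comp,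
      inner_shift_shift, ih]

theorem norm_shift_pow (n : ℕ) (f : HardyTwo) : ‖(shift ^ n) f‖ = ‖f‖ := by
  induction n with
  | zero => simp
  | succ n ih => rw [pow_succ', mul_apply_eq_comp, norm_shift, ih]

/-- The shift is pure: a subspace all of whose members are divisible by `z` within the subspace
is zero. -/
theorem eq_zero_of_forall_exists_shift {M : Set HardyTwo}
    (h : ∀ f ∈ M, ∃ g ∈ M, shift g = f) {f : HardyTwo} (hf : f ∈ M) : f = 0 := by
  have key : ∀ n : ℕ, ∀ f ∈ M, coeff f n = 0 := by
    intro n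
    induction n with
    | zero =>
      intro f hf
      obtain ⟨g, _, rfl⟩ := h f hf
      exact coeff_shiftLinear g 0
    | succ n ih =>
      intro f hf
      obtain ⟨g, hg, rfl⟩ := h f hf
      exact (coeff_shiftLinear g (n + 1)).trans (ih g hg)
  apply coeff.injective
  rw [map_zero]
  ext n
  exact key n f hf

/-! ### Beurling's theorem -/

/-- An isometry of `H²` that multiplies by a function on the disc. This is how inner functions
are encoded here, without reference to boundary values. -/
def IsMultiplication (U : HardyTwo →ₗᵢ[ℂ] HardyTwo) : Prop :=
  ∃ φ : 𝔻 → ℂ, ∀ f z, U f z = φ z * f z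

theorem IsMultiplication.comm {U V : HardyTwo →ₗᵢ[ℂ] HardyTwo} (hU : IsMultiplication U)
    (hV : IsMultiplication V) (f : HardyTwo) : U (V f) = V (U f) := by
  obtain ⟨φ, hφ⟩ := hU
  obtain ⟨ψ, hψ⟩ := hV
  ext z
  simp only [hφ, hψ]
  ring

/-- The range of an isometry, as a closed subspace. -/
def closedRange (U : HardyTwo →ₗᵢ[ℂ] HardyTwo) : ClosedSubmodule ℂ HardyTwo where
  toSubmodule := LinearMap.range U.toLinearMap
  isClosed' := by
    have h := U.isometry.isClosedEmbedding.isClosed_range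
    simpa [LinearMap.coe_range] using h

theorem mem_closedRange {U : HardyTwo →ₗᵢ[ℂ] HardyTwo} {f : HardyTwo} :
    f ∈ closedRange U ↔ ∃ g, U g = f := Iff.rfl

/-- A nonzero closed invariant subspace `M` of the shift contains a unit vector orthogonal
to `z M`. -/
theorem exists_wandering {M : ClosedSubmodule ℂ HardyTwo} (hM : ∀ f ∈ M, shift f ∈ M)
    (h0 : M ≠ ⊥) : ∃ φ ∈ M, ‖φ‖ = 1 ∧ ∀ g ∈ M, inner ℂ φ (shift g) = 0 := by
  by_contra! hcon
  have hzero : ∀ φ ∈ M, (∀ g ∈ M, inner ℂ φ (shift g) = 0) → φ = 0 := by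
    intro φ hφ hort
    by_contra hne
    obtain ⟨g, hg, hg'⟩ := hcon (((‖φ‖ : ℂ)⁻¹) • φ) (M.toSubmodule.smul_mem _ hφ)
      (norm_smul_inv_norm hne)
    exact hg' (by rw [inner_smul_left, hort g hg, mul_zero])
  have hMc : CompleteSpace M.toSubmodule := M.isClosed.completeSpace_coe
  let K : Submodule ℂ HardyTwo := M.toSubmodule.map shiftIsometry.toLinearMap
  have hKc : CompleteSpace K := LinearIsometry.completeSpace_map shiftIsometry M.toSubmodule
  have hKM : ∀ f ∈ K, f ∈ M := by
    rintro _ ⟨g, hg, rfl⟩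
    exact hM g hg
  have hdiv : ∀ f ∈ (M : Set HardyTwo), ∃ g ∈ (M : Set HardyTwo), shift g = f := by
    intro f hf
    have hp : (K.starProjection f) ∈ K := K.starProjection_apply_mem f
    have hz := hzero (f - K.starProjection f) (M.toSubmodule.sub_mem hf (hKM _ hp))
      (fun g hg => K.inner_left_of_mem_orthogonal (Submodule.mem_map_of_mem hg)
        (K.sub_starProjection_mem_orthogonal f))
    rw [← sub_eq_zero.1 hz] at hp
    obtain ⟨g, hg, hgf⟩ := hp
    exact ⟨g, hg, hgf⟩
  apply h0
  rw [eq_bot_iff]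
  intro f hf
  exact eq_zero_of_forall_exists_shift hdiv hf

theorem shift_pow_mem {M : ClosedSubmodule ℂ HardyTwo} (hM : ∀ f ∈ M, shift f ∈ M) (n : ℕ)
    {f : HardyTwo} (hf : f ∈ M) : (shift ^ n) f ∈ M := by
  induction n with
  | zero => simpa using hf
  | succ n ih =>
    rw [pow_succ', mul_apply_eq_comp]
    exact hM _ ih

theorem orthonormal_shift_pow {M : ClosedSubmodule ℂ HardyTwo} (hM : ∀ f ∈ M, shift f ∈ M)
    {φ : HardyTwo} (hφ : φ ∈ M) (h1 : ‖φ‖ = 1) (hort : ∀ g ∈ M, inner ℂ φ (shift g) = 0) :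
    Orthonormal ℂ (fun n : ℕ => (shift ^ n) φ) := by
  have key : ∀ i k : ℕ, inner ℂ ((shift ^ i) φ) ((shift ^ (i + (k + 1))) φ) = 0 := by
    intro i k
    rw [pow_add, mul_apply_eq_comp, inner_shift_pow, pow_succ',
      mul_apply_eq_comp]
    exact hort _ (shift_pow_mem hM k hφ)
  refine ⟨fun n => (norm_shift_pow n φ).trans h1, fun i j hij => ?_⟩
  rcases lt_or_gt_of_ne hij with h | h
  · obtain ⟨k, rfl⟩ := Nat.exists_eq_add_of_lt h
    exact key i k
  · obtain ⟨k, rfl⟩ := Nat.exists_eq_add_of_lt h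
    rw [inner_eq_zero_symm]
    exact key j k

/-- If the functions `zⁿ φ` are orthonormal, then `φ` is inner: multiplication by `φ` is an isometry
of `H²`. Its range is contained in the closed span of the functions `zⁿ φ`. -/
theorem exists_isometry_mul {φ : HardyTwo} (hφ : Orthonormal ℂ (fun n : ℕ => (shift ^ n) φ)) :
    ∃ U : HardyTwo →ₗᵢ[ℂ] HardyTwo, (∀ f z, U f z = φ z * f z) ∧
      ∀ K : ClosedSubmodule ℂ HardyTwo, (∀ n : ℕ, (shift ^ n) φ ∈ K) → ∀ f, U f ∈ K := by
  have hV := hφ.orthogonalFamily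
  let U : HardyTwo →ₗᵢ[ℂ] HardyTwo := hV.linearIsometry.comp coeffIsometry.toLinearIsometry
  have hsum : ∀ f, HasSum (fun n => coeff f n • (shift ^ n) φ) (U f) :=
    fun f => hV.hasSum_linearIsometry (coeff f)
  refine ⟨U, fun f z => ?_, fun K hK f => ?_⟩
  · have he := (hsum f).mapL (evalCLM z)
    simp only [evalCLM_apply, smul_apply, shift_pow_apply] at he
    refine he.unique (((coeff_hasSum f z).mul_left (φ z)).congr_fun fun n => ?_)
    ring
  · refine K.isClosed.mem_of_tendsto (hsum f) (Filter.Eventually.of_forall fun s => ?_)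
    exact K.toSubmodule.sum_mem fun n _ => K.toSubmodule.smul_mem _ (hK n)

theorem exists_forall_apply_eq_one : ∃ e : HardyTwo, ∀ z, e z = 1 := by
  have hone : Memℓp (fun n : ℕ => if n = 0 then (1 : ℂ) else 0) 2 := by
    refine (EllTwo.memlp_two_iff _).2 (summable_of_ne_finset_zero (s := {0}) fun n hn => ?_)
    simp [Finset.mem_singleton.not.1 hn]
  refine ⟨ofCoeff ⟨_, hone⟩, fun z => (ofCoeff_hasSum ⟨_, hone⟩ z).unique ?_⟩
  have h := hasSum_single (f := fun n : ℕ => (if n = 0 then (1 : ℂ) else 0) * (z : ℂ) ^ n) 0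
    (fun n hn => by simp [hn])
  simpa using h

/-- Beurling's theorem: a nonzero closed invariant subspace of the shift is `φ H²` for an inner
function `φ`. -/
theorem exists_isMultiplication_range_eq {M : ClosedSubmodule ℂ HardyTwo}
    (hM : ∀ f ∈ M, shift f ∈ M) (h0 : M ≠ ⊥) :
    ∃ U, IsMultiplication U ∧ closedRange U = M := by
  obtain ⟨φ, hφ, h1, hort⟩ := exists_wandering hM h0
  obtain ⟨U, hU, hUK⟩ := exists_isometry_mul (orthonormal_shift_pow hM hφ h1 hort)
  obtain ⟨e, he⟩ := exists_forall_apply_eq_one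
  have hle : closedRange U ≤ M := by
    rintro _ ⟨g, rfl⟩
    exact hUK M (fun n => shift_pow_mem hM n hφ) g
  have hUpow : ∀ n : ℕ, U ((shift ^ n) e) = (shift ^ n) φ := by
    intro n
    ext z
    rw [hU, shift_pow_apply, shift_pow_apply, he, mul_one, mul_comm]
  -- `M'` is the part of `M` that the range of `U` misses.
  let M' : ClosedSubmodule ℂ HardyTwo := M ⊓ (closedRange U)ᗮ
  have hmem : ∀ f, f ∈ M' ↔ f ∈ M ∧ ∀ g, inner ℂ (U g) f = 0 := by
    intro f
    refine and_congr Iff.rfl ⟨fun h g => h (U g) ⟨g, rfl⟩, ?_⟩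
    rintro h _ ⟨g, rfl⟩
    exact h g
  have hM' : ∀ f ∈ M', shift f ∈ M' := by
    intro f hf
    rw [hmem] at hf ⊢
    refine ⟨hM f hf.1, fun g => ?_⟩
    -- It suffices to test against `zⁿ φ`: for `n = 0` this is the choice of `φ`, and for `n + 1`
    -- one factor `z` cancels.
    let K : ClosedSubmodule ℂ HardyTwo := ⟨(ℂ ∙ shift f)ᗮ, Submodule.isClosed_orthogonal _⟩
    have hK : ∀ x, x ∈ K ↔ inner ℂ x (shift f) = 0 := fun x =>
      Submodule.mem_orthogonal_singleton_iff_inner_left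
    refine (hK _).1 (hUK K (fun n => (hK _).2 ?_) g)
    cases n with
    | zero => simpa using hort f hf.1
    | succ n =>
      rw [pow_succ', mul_apply_eq_comp, inner_shift_shift, ← hUpow]
      exact hf.2 _
  have hbot : M' = ⊥ := by
    by_contra hne
    obtain ⟨ψ, hψ, hψ1, hψort⟩ := exists_wandering hM' hne
    obtain ⟨V, hV, hVK⟩ := exists_isometry_mul (orthonormal_shift_pow hM' hψ hψ1 hψort)
    have hcomm : U ψ = V φ := by
      ext z
      rw [hU, hV, mul_comm]
    -- `φ ψ` lies in the range of `U` and is orthogonal to it.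
    have h := ((hmem _).1 (hVK M' (fun n => shift_pow_mem hM' n hψ) φ)).2 ψ
    rw [hcomm, inner_self_eq_zero] at h
    have hn := V.norm_map φ
    rw [h, norm_zero, h1] at hn
    exact zero_ne_one hn
  refine ⟨U, ⟨φ, hU⟩, le_antisymm hle fun f hf => ?_⟩
  let R : Submodule ℂ HardyTwo := (closedRange U).toSubmodule
  have hRc : CompleteSpace R := (closedRange U).isClosed.completeSpace_coe
  have hp : R.starProjection f ∈ R := R.starProjection_apply_mem f
  have hz : f - R.starProjection f ∈ M' :=
    ⟨M.toSubmodule.sub_mem hf (hle hp), R.sub_starProjection_mem_orthogonal f⟩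
  rw [hbot, ClosedSubmodule.mem_bot, sub_eq_zero] at hz
  rw [hz]
  exact hp

/-! ### Distributivity for the shift -/

/-- In ideal notation, `L N ≤ Q P` whenever `L, N ≤ Q` and `L ∩ N ≤ P`, where `L`, `N`, `Q` and `P`
are the ranges of `l`, `n`, `q` and `p`. -/
theorem comp_mem_range_comp {l n q p : HardyTwo →ₗᵢ[ℂ] HardyTwo} (hl : IsMultiplication l)
    (hn : IsMultiplication n) (hq : IsMultiplication q) (hlq : closedRange l ≤ closedRange q)
    (hnq : closedRange n ≤ closedRange q) (hp : closedRange l ⊓ closedRange n ≤ closedRange p)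
    (h : HardyTwo) : l (n h) ∈ closedRange (q.comp p) := by
  obtain ⟨g, hg⟩ := hnq (⟨h, rfl⟩ : n h ∈ closedRange n)
  obtain ⟨g', hg'⟩ := hlq (⟨h, rfl⟩ : l h ∈ closedRange l)
  replace hg : q g = n h := hg
  replace hg' : q g' = l h := hg'
  -- Dividing `l n h` by `q` in the two possible ways gives an element of `L ∩ N`.
  have hlg : n g' = l g := by
    apply q.injective
    rw [hq.comm hn, hq.comm hl, hg, hg', hn.comm hl]
  obtain ⟨k, hk⟩ := hp (⟨⟨g, rfl⟩, ⟨g', hlg⟩⟩ : l g ∈ closedRange l ⊓ closedRange n)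
  refine ⟨k, ?_⟩
  change q (p k) = l (n h)
  rw [show p k = l g from hk, hq.comm hl, hg]

/-- The lattice of closed invariant subspaces of the shift is distributive. (The order lemmas are
given the type of closed subspaces of `H²` explicitly, since unification does not find its lattice
structure.) -/
theorem shift_inf_sup_le {L M N : ClosedSubmodule ℂ HardyTwo} (hL : L ∈ invariantLattice shift)
    (hM : M ∈ invariantLattice shift) (hN : N ∈ invariantLattice shift) :
    L ⊓ (M ⊔ N) ≤ (L ⊓ M) ⊔ (L ⊓ N) := by
  rcases eq_or_ne M ⊥ with rfl | hM0
  · exact (inf_le_inf_left L (sup_le (α := ClosedSubmodule ℂ HardyTwo) bot_le le_rfl)).trans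
      (le_sup_right (α := ClosedSubmodule ℂ HardyTwo))
  rcases eq_or_ne N ⊥ with rfl | hN0
  · exact (inf_le_inf_left L (sup_le (α := ClosedSubmodule ℂ HardyTwo) le_rfl bot_le)).trans
      (le_sup_left (α := ClosedSubmodule ℂ HardyTwo))
  rcases eq_or_ne (L ⊓ (M ⊔ N)) ⊥ with hW0 | hW0
  · rw [hW0]
    exact bot_le
  have hL0 : L ≠ ⊥ := by
    rintro rfl
    simp at hW0
  have hLM := (invariantLattice shift).infClosed hL hM
  have hLN := (invariantLattice shift).infClosed hL hN
  have hMN := (invariantLattice shift).supClosed hM hN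
  have hPm := (invariantLattice shift).supClosed hLM hLN
  have hQm := (invariantLattice shift).supClosed hL hMN
  have hWm := (invariantLattice shift).infClosed hL hMN
  obtain ⟨l, hl, rfl⟩ := exists_isMultiplication_range_eq hL hL0
  obtain ⟨m, hm, rfl⟩ := exists_isMultiplication_range_eq hM hM0
  obtain ⟨n, hn, rfl⟩ := exists_isMultiplication_range_eq hN hN0
  have hP0 : closedRange l ⊓ closedRange m ⊔ closedRange l ⊓ closedRange n ≠ ⊥ := by
    intro h0
    obtain ⟨φ, -, h1, -⟩ := exists_wandering hL hL0
    have hlm : l (m φ) ∈ closedRange l ⊓ closedRange m :=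
      ⟨⟨m φ, rfl⟩, ⟨l φ, hm.comm hl φ⟩⟩
    have hz : l (m φ) = 0 := by
      have hz' := (le_sup_left (b := closedRange l ⊓ closedRange n)) hlm
      rwa [h0] at hz'
    have hnorm := (l.norm_map (m φ)).trans (m.norm_map φ)
    rw [hz, norm_zero, h1] at hnorm
    exact zero_ne_one hnorm
  have hQ0 : closedRange l ⊔ (closedRange m ⊔ closedRange n) ≠ ⊥ :=
    fun h => hL0 (le_bot_iff.1 (h ▸ le_sup_left (α := ClosedSubmodule ℂ HardyTwo)))
  obtain ⟨p, hp, hPeq⟩ := exists_isMultiplication_range_eq hPm hP0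
  obtain ⟨q, hq, hQeq⟩ := exists_isMultiplication_range_eq hQm hQ0
  obtain ⟨w, hw, hWeq⟩ := exists_isMultiplication_range_eq hWm hW0
  have hlq : closedRange l ≤ closedRange q := hQeq ▸ le_sup_left
  have hmq : closedRange m ≤ closedRange q := hQeq ▸ le_sup_left.trans le_sup_right
  have hnq : closedRange n ≤ closedRange q := hQeq ▸ le_sup_right.trans le_sup_right
  have hlm := comp_mem_range_comp hl hm hq hlq hmq (p := p) (hPeq ▸ le_sup_left)
  have hln := comp_mem_range_comp hl hn hq hlq hnq (p := p) (hPeq ▸ le_sup_right)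
  have hwL : ∀ h, w h ∈ closedRange l := fun h =>
    (hWeq ▸ ⟨h, rfl⟩ : w h ∈ closedRange l ⊓ (closedRange m ⊔ closedRange n)).1
  have hwMN : ∀ h, w h ∈ closedRange m ⊔ closedRange n := fun h =>
    (hWeq ▸ ⟨h, rfl⟩ : w h ∈ closedRange l ⊓ (closedRange m ⊔ closedRange n)).2
  -- In ideal notation, `L (M ∨ N) ≤ Q P`.
  have hprod : closedRange m ⊔ closedRange n ≤
      (closedRange (q.comp p)).comap l.toContinuousLinearMap := by
    refine sup_le (α := ClosedSubmodule ℂ HardyTwo) ?_ ?_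
    · rintro _ ⟨h, rfl⟩
      exact hlm h
    · rintro _ ⟨h, rfl⟩
      exact hln h
  -- In ideal notation, `(L ∩ (M ∨ N)) Q ≤ Q P`.
  have hcomap : closedRange q ≤ (closedRange (q.comp p)).comap w.toContinuousLinearMap := by
    rw [hQeq]
    refine sup_le (α := ClosedSubmodule ℂ HardyTwo) ?_ (sup_le (α := ClosedSubmodule ℂ HardyTwo) ?_ ?_)
    · rintro _ ⟨h, rfl⟩
      change w (l h) ∈ closedRange (q.comp p)
      rw [hw.comm hl]
      exact hprod (hwMN h)
    · rintro _ ⟨h, rfl⟩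
      obtain ⟨k, hk⟩ := hwL h
      change w (m h) ∈ closedRange (q.comp p)
      rw [hw.comm hm, ← show l k = w h from hk, hm.comm hl]
      exact hlm k
    · rintro _ ⟨h, rfl⟩
      obtain ⟨k, hk⟩ := hwL h
      change w (n h) ∈ closedRange (q.comp p)
      rw [hw.comm hn, ← show l k = w h from hk, hn.comm hl]
      exact hln k
  rw [← hWeq, ← hPeq]
  rintro _ ⟨h, rfl⟩
  obtain ⟨k, hk⟩ := hcomap (⟨h, rfl⟩ : q h ∈ closedRange q)
  refine ⟨k, q.injective ?_⟩
  exact (show q (p k) = w (q h) from hk).trans (hw.comm hq h)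

/-! ### From the shift to the Jordan block -/

theorem shift_mem_multiples {θ : ℂ → ℂ} {f : HardyTwo} (hf : f ∈ multiples θ) :
    shift f ∈ multiples θ := by
  obtain ⟨g, hg⟩ := hf
  refine ⟨shift g, fun z => ?_⟩
  rw [shift_apply, shift_apply, hg]
  ring

theorem shift_mem_orthogonal_modelSpace {θ : ℂ → ℂ} {f : HardyTwo} (hf : f ∈ (modelSpace θ)ᗮ) :
    shift f ∈ (modelSpace θ)ᗮ := by
  rw [Submodule.orthogonal_orthogonal_eq_closure] at hf ⊢
  exact map_mem_closure shift.continuous hf fun _ h => shift_mem_multiples h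

/-- The subspace of `H²` of the functions whose projection to the model space lies in `N`. -/
def lift (θ : ℂ → ℂ) (N : ClosedSubmodule ℂ (modelSpace θ)) : ClosedSubmodule ℂ HardyTwo :=
  N.comap (modelSpace θ).orthogonalProjectionOnto

theorem mem_lift {θ : ℂ → ℂ} {N : ClosedSubmodule ℂ (modelSpace θ)} {f : HardyTwo} :
    f ∈ lift θ N ↔ (modelSpace θ).orthogonalProjectionOnto f ∈ N := Iff.rfl

theorem coe_mem_lift {θ : ℂ → ℂ} {N : ClosedSubmodule ℂ (modelSpace θ)} {x : modelSpace θ} :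
    (x : HardyTwo) ∈ lift θ N ↔ x ∈ N := by
  rw [mem_lift, Submodule.orthogonalProjectionOnto_mem_subspace_eq_self]

theorem mem_lift_of_mem_orthogonal {θ : ℂ → ℂ} (N : ClosedSubmodule ℂ (modelSpace θ))
    {f : HardyTwo} (hf : f ∈ (modelSpace θ)ᗮ) : f ∈ lift θ N := by
  rw [mem_lift, Submodule.orthogonalProjectionOnto_eq_zero_iff.2 hf]
  exact N.toSubmodule.zero_mem

theorem lift_mem_invariantLattice {θ : ℂ → ℂ} {N : ClosedSubmodule ℂ (modelSpace θ)}
    (hN : N ∈ invariantLattice (jordanBlock θ)) : lift θ N ∈ invariantLattice shift := by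
  intro f hf
  -- Split `f` into its projection to the model space and the rest.
  have h1 : shift ((modelSpace θ).orthogonalProjectionOnto f : HardyTwo) ∈ lift θ N :=
    hN _ (mem_lift.1 hf)
  have h2 : shift (f - (modelSpace θ).orthogonalProjectionOnto f) ∈ lift θ N :=
    mem_lift_of_mem_orthogonal N (shift_mem_orthogonal_modelSpace
      ((modelSpace θ).sub_starProjection_mem_orthogonal f))
  have h := (lift θ N).toSubmodule.add_mem h1 h2
  rwa [← map_add, add_sub_cancel] at h

theorem lift_sup_le (θ : ℂ → ℂ) (M N : ClosedSubmodule ℂ (modelSpace θ)) :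
    M ⊔ N ≤ (lift θ M ⊔ lift θ N).comap (modelSpace θ).subtypeL :=
  sup_le (α := ClosedSubmodule ℂ (modelSpace θ))
    (fun _ hx => le_sup_left (α := ClosedSubmodule ℂ HardyTwo) (coe_mem_lift.2 hx))
    (fun _ hx => le_sup_right (α := ClosedSubmodule ℂ HardyTwo) (coe_mem_lift.2 hx))

/-- The lattice of closed invariant subspaces of a Jordan block is distributive. -/
theorem jordanBlock_inf_sup_le {θ : ℂ → ℂ} {L M N : ClosedSubmodule ℂ (modelSpace θ)}
    (hL : L ∈ invariantLattice (jordanBlock θ)) (hM : M ∈ invariantLattice (jordanBlock θ))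
    (hN : N ∈ invariantLattice (jordanBlock θ)) :
    L ⊓ (M ⊔ N) ≤ (L ⊓ M) ⊔ (L ⊓ N) := by
  rintro x ⟨hxL, hxMN⟩
  have hx := shift_inf_sup_le (lift_mem_invariantLattice hL) (lift_mem_invariantLattice hM)
    (lift_mem_invariantLattice hN)
    (⟨coe_mem_lift.2 hxL, lift_sup_le θ M N hxMN⟩ :
      (x : HardyTwo) ∈ lift θ L ⊓ (lift θ M ⊔ lift θ N))
  have hle : lift θ L ⊓ lift θ M ⊔ lift θ L ⊓ lift θ N ≤ lift θ (L ⊓ M ⊔ L ⊓ N) :=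
    sup_le (α := ClosedSubmodule ℂ HardyTwo)
      (fun _ hf => le_sup_left (α := ClosedSubmodule ℂ (modelSpace θ))
        ⟨mem_lift.1 hf.1, mem_lift.1 hf.2⟩)
      (fun _ hf => le_sup_right (α := ClosedSubmodule ℂ (modelSpace θ))
        ⟨mem_lift.1 hf.1, mem_lift.1 hf.2⟩)
  exact coe_mem_lift.1 (hle hx)

end

end HardyTwo

theorem mainTheorem6 (θ : ℂ → ℂ) (hθ : IsInnerFunction θ)
    (L M N : invariantLattice (HardyTwo.jordanBlock θ)) :
    L ⊓ (M ⊔ N) = (L ⊓ M) ⊔ (L ⊓ N) :=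
  le_antisymm (HardyTwo.jordanBlock_inf_sup_le L.2 M.2 N.2) le_inf_sup
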